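/- Let $1\le p\le q<s<\infty$ and $1\le r\le s$ be real numbers, and let $U$, $X$, $Y$ be Banach spaces over $\mathbb K=\mathbb R$ or $\mathbb C$. For a Banach space $E$, let $\ell_r(E)$ be the space of absolutely $r$-summable sequences in $E$, and $\ell_p^w(E)$ the space of weakly $p$-summable sequences, that is, of all $(u_j)_j$ in $E$ with $(\varphi(u_j))_j\in\ell_p$ for every $\varphi\in E^*$. For finite or infinite sequences put $\|(x_k)_k\|_r=(\sum_k\|x_k\|^r)^{1/r}$ and $\|(u_j)_j\|_{w,p}=\sup_{\varphi\in B_{E^*}}(\sum_j|\varphi(u_j)|^p)^{1/p}$. A bounded linear operator $T:U\to Y$ is called weakly anisotropic $(s,q,r;p)$-summing if $$\sum_{j=1}^\infty\Big(\sum_{k=1}^\infty|y_k^*(T(u_j))|^s\Big)^{q/s}<\infty\quad\text{for all }(u_j)_j\in\ell_p^w(U)\text{ and }(y_k^*)_k\in\ell_r(Y^*).$$ Its norm $w^A_{(s,q,r;p)}(T)$ is then the infimum of all $D>0$ such that $$\Big(\sum_{j=1}^m\Big(\sum_{k=1}^n|y_k^*(T(u_j))|^s\Big)^{q/s}\Big)^{1/q}\le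 D\,\|(y_k^*)_{k=1}^n\|_r\,\|(u_j)_{j=1}^m\|_{w,p}$$ for all $m,n\in\mathbb N$, $u_1,\dots,u_m\in U$ and $y_1^*,\dots,y_n^*\in Y^*$. Let $T\in\mathcal L(U;X^*)$. Then the following are equivalent: (1) $T$ is weakly anisotropic $(s,q,r;p)$-summing (as an operator into $Y=X^*$, so that the functionals $y^*_k$ range over $X^{**}$). (2) There is $D>0$ such that for all $(u_j)_{j=1}^\infty\in\ell_p^w(U)$ and $(x_k)_{k=1}^\infty\in\ell_r(X)$ $$\Big(\sum_{j=1}^\infty\Big(\sum_{k=1}^\infty|T(u_j)(x_k)|^s\Big)^{q/s}\Big)^{1/q}\le D\,\|(x_k)_{k=1}^\infty\|_r\,\|(u_j)_{j=1}^\infty\|_{w,p}.$$ (3) There is $D>0$ such that for all $m\in\mathbb N$, $u_1,\dots,u_m\in U$ and $(x_k)_{k=1}^\infty\in\ell_r(X)$ $$\Big(\sum_{j=1}^m\Big(\sum_{k=1}^\infty|T(u_j)(x_k)|^s\Big)^{q/s}\Big)^{1/q}\le D\,\|(x_k)_{k=1}^\infty\|_r\,\|(u_j)_{j=1}^m\|_{w,p}.$$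 (4) There is $D>0$ such that for all $m,n\in\mathbb N$, $u_1,\dots,u_m\in U$ and $x_1,\dots,x_n\in X$ $$\Big(\sum_{j=1}^m\Big(\sum_{k=1}^n|T(u_j)(x_k)|^s\Big)^{q/s}\Big)^{1/q}\le D\,\|(x_k)_{k=1}^n\|_r\,\|(u_j)_{j=1}^m\|_{w,p}.$$ If these conditions hold, then $w^A_{(s,q,r;p)}(T)$ is the infimum of the constants $D>0$ satisfying the inequality in (2), and likewise the infimum of those satisfying the inequality in (3), and of those satisfying the inequality in (4). Moreover the inequality in (2) holds with $D=w^A_{(s,q,r;p)}(T)$. -/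

import Mathlib

open scoped ENNReal

noncomputable section

namespace AnisotropicSumming

/-- The norm `(∑ ‖x_k‖ ^ r) ^ (1 / r)` of a finite or infinite family of vectors, with value in
`[0, ∞]`. -/
def strongNorm {ι E : Type*} [NormedAddCommGroup E] (r : ℝ) (x : ι → E) : ℝ≥0∞ :=
  (∑' k, ‖x k‖ₑ ^ r) ^ (1 / r)

/-- `x ∈ ℓ_r(E)`: the sequence `x` is absolutely `r`-summable. -/
def MemStrong {E : Type*} [NormedAddCommGroup E] (r : ℝ) (x : ℕ → E) : Prop :=
  Memℓp x (ENNReal.ofReal r)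

/-- The norm `sup {‖(φ(u_j))_j‖_p : φ ∈ B_{E*}}` of a finite or infinite family of vectors, with
value in `[0, ∞]`. -/
def weakNorm (𝕜 : Type*) {ι E : Type*} [RCLike 𝕜] [NormedAddCommGroup E] [NormedSpace 𝕜 E]
    (p : ℝ) (u : ι → E) : ℝ≥0∞ :=
  ⨆ φ ∈ Metric.closedBall (0 : StrongDual 𝕜 E) 1, strongNorm p (fun j => φ (u j))

/-- `u ∈ ℓ_p^w(E)`: the sequence `u` is weakly `p`-summable. -/
def MemWeak (𝕜 : Type*) {E : Type*} [RCLike 𝕜] [NormedAddCommGroup E] [NormedSpace 𝕜 E]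
    (p : ℝ) (u : ℕ → E) : Prop :=
  ∀ φ : StrongDual 𝕜 E, MemStrong p (fun j => φ (u j))

/-- The mixed norm `(∑_j (∑_k |a_{jk}| ^ s) ^ (q / s)) ^ (1 / q)` of a finite or infinite matrix of
scalars, with value in `[0, ∞]`. -/
def mixedNorm {ι κ 𝕜 : Type*} [RCLike 𝕜] (s q : ℝ) (a : ι → κ → 𝕜) : ℝ≥0∞ :=
  (∑' j, (∑' k, ‖a j k‖ₑ ^ s) ^ (q / s)) ^ (1 / q)

/-- `x ∈ ℓ^A_{(s,q,r)}(E)`: the sequence `x` is anisotropic `(s,q,r)`-summable. -/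
def MemAnisotropic (𝕜 : Type*) {E : Type*} [RCLike 𝕜] [NormedAddCommGroup E] [NormedSpace 𝕜 E]
    (s q r : ℝ) (x : ℕ → E) : Prop :=
  ∀ φ : ℕ → StrongDual 𝕜 E, MemStrong r φ →
    ∑' j, (∑' k, ‖φ k (x j)‖ₑ ^ s) ^ (q / s) < ∞

section Operators

variable {𝕜 U Y : Type*} [RCLike 𝕜] [NormedAddCommGroup U] [NormedSpace 𝕜 U]
  [NormedAddCommGroup Y] [NormedSpace 𝕜 Y]

/-- `T` is weakly anisotropic `(s,q,r;p)`-summing. -/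
def IsWeaklyAnisotropicSumming (s q r p : ℝ) (T : U →L[𝕜] Y) : Prop :=
  ∀ u : ℕ → U, MemWeak 𝕜 p u → MemAnisotropic 𝕜 s q r (fun j => T (u j))

/-- The norm `w^A_{(s,q,r;p)}(T)` of a weakly anisotropic `(s,q,r;p)`-summing operator: the infimum
of the constants `D > 0` in the defining inequality for finite families in `U` and in `Y*`. -/
def weakAnisotropicNorm (s q r p : ℝ) (T : U →L[𝕜] Y) : ℝ :=
  sInf {D : ℝ | 0 < D ∧ ∀ (m n : ℕ) (u : Fin m → U) (φ : Fin n → StrongDual 𝕜 Y),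
    mixedNorm s q (fun j k => φ k (T (u j))) ≤
      ENNReal.ofReal D * strongNorm r φ * weakNorm 𝕜 p u}

end Operators

section DualTarget

variable {𝕜 U X : Type*} [RCLike 𝕜] [NormedAddCommGroup U] [NormedSpace 𝕜 U]
  [NormedAddCommGroup X] [NormedSpace 𝕜 X]

/-- The inequality with constant `D`, for sequences in `U` and sequences in the predual `X`. -/
def PredualBound (s q r p : ℝ) (T : U →L[𝕜] StrongDual 𝕜 X) (D : ℝ) : Prop :=
  ∀ (u : ℕ → U) (x : ℕ → X), MemWeak 𝕜 p u → MemStrong r x →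
    mixedNorm s q (fun j k => T (u j) (x k)) ≤
      ENNReal.ofReal D * strongNorm r x * weakNorm 𝕜 p u

/-- The inequality with constant `D`, for finite families in `U` and sequences in `X`. -/
def PredualBoundSemifinite (s q r p : ℝ) (T : U →L[𝕜] StrongDual 𝕜 X) (D : ℝ) : Prop :=
  ∀ (m : ℕ) (u : Fin m → U) (x : ℕ → X), MemStrong r x →
    mixedNorm s q (fun j k => T (u j) (x k)) ≤
      ENNReal.ofReal D * strongNorm r x * weakNorm 𝕜 p u

/-- The inequality with constant `D`, for finite families in `U` and in `X`. -/
def PredualBoundFinite (s q r p : ℝ) (T : U →L[𝕜] StrongDual 𝕜 X) (D : ℝ) : Prop :=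
  ∀ (m n : ℕ) (u : Fin m → U) (x : Fin n → X),
    mixedNorm s q (fun j k => T (u j) (x k)) ≤
      ENNReal.ofReal D * strongNorm r x * weakNorm 𝕜 p u

end DualTarget

end AnisotropicSumming

end

/-! All four conditions reduce to inequalities for finite families, and the admissible constants `D`
are the same throughout. Conditions (2), (3) and (4) share their constants: finite families are
sequences padded by zeros, and infinite mixed norms are controlled by finite sections. Passing
between `X` and `X**` costs nothing on finite families (`finiteBound_iff_predualBoundFinite`). The
canonical embedding does not increase norms, and by Goldstine each functional in `X**` is a limit,
on the finitely many `T (u j)`, of vectors of `X` of no larger norm. The qualitative condition (1)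
yields a finite bound by a gluing argument (`IsWeaklyAnisotropicSumming.exists_finiteBound`).
Conversely, a finite bound gives (1) because weakly `p`-summable sequences have finite weak norm.
Equal sets of constants have equal infima, and the infimum is admissible because the finite
inequality is closed in `D`. -/

namespace AnisotropicSumming

open Filter Topology

/-! ### Strong, weak and mixed norms: scaling, reindexing, finite sections -/

section Norms

variable {ι κ ι' κ' 𝕜 E : Type*} [RCLike 𝕜] [NormedAddCommGroup E] [NormedSpace 𝕜 E]

theorem strongNorm_lt_top_iff {r : ℝ} (hr : 0 < r) (x : ι → E) :
    strongNorm r x < ∞ ↔ ∑' k, ‖x k‖ₑ ^ r < ∞ :=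
  ENNReal.rpow_lt_top_iff_of_pos (one_div_pos.2 hr)

theorem strongNorm_rpow {r : ℝ} (hr : 0 < r) (x : ι → E) :
    strongNorm r x ^ r = ∑' k, ‖x k‖ₑ ^ r := by
  rw [strongNorm, ← ENNReal.rpow_mul, one_div_mul_cancel hr.ne', ENNReal.rpow_one]

theorem memStrong_iff {r : ℝ} (hr : 0 < r) (x : ℕ → E) : MemStrong r x ↔ strongNorm r x < ∞ := by
  have hr' : (ENNReal.ofReal r).toReal = r := ENNReal.toReal_ofReal hr.le
  have h (k : ℕ) : ‖x k‖ₑ ^ r = ((‖x k‖₊ ^ r : NNReal) : ℝ≥0∞) := by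
    rw [ENNReal.coe_rpow_of_nonneg _ hr.le]; rfl
  rw [strongNorm_lt_top_iff hr, MemStrong, memℓp_gen_iff (by rwa [hr']), hr', lt_top_iff_ne_top]
  simp_rw [h]
  rw [ENNReal.tsum_coe_ne_top_iff_summable, ← NNReal.summable_coe]
  simp

theorem enorm_le_strongNorm {r : ℝ} (hr : 0 < r) (x : ι → E) (k : ι) : ‖x k‖ₑ ≤ strongNorm r x := by
  rw [← ENNReal.rpow_le_rpow_iff hr, strongNorm_rpow hr]
  exact ENNReal.le_tsum (f := fun k => ‖x k‖ₑ ^ r) k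

theorem strongNorm_mono {F : Type*} [NormedAddCommGroup F] {r : ℝ} (hr : 0 < r) {x : ι → E}
    {y : ι → F} (h : ∀ k, ‖x k‖ₑ ≤ ‖y k‖ₑ) : strongNorm r x ≤ strongNorm r y :=
  ENNReal.rpow_le_rpow (ENNReal.tsum_le_tsum fun k => ENNReal.rpow_le_rpow (h k) hr.le)
    (one_div_pos.2 hr).le

theorem strongNorm_lt_top_of_finite [Finite ι] {r : ℝ} (hr : 0 < r) (x : ι → E) :
    strongNorm r x < ∞ := by
  have := Fintype.ofFinite ι
  rw [strongNorm_lt_top_iff hr, tsum_fintype]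
  exact ENNReal.sum_lt_top.2 fun k _ => ENNReal.rpow_lt_top_of_nonneg hr.le (by simp)

theorem strongNorm_smul {r : ℝ} (hr : 0 < r) (c : 𝕜) (x : ι → E) :
    strongNorm r (fun k => c • x k) = ‖c‖ₑ * strongNorm r x := by
  simp only [strongNorm, enorm_smul]
  simp_rw [ENNReal.mul_rpow_of_nonneg _ _ hr.le]
  rw [ENNReal.tsum_mul_left, ENNReal.mul_rpow_of_nonneg _ _ (one_div_pos.2 hr).le,
    ← ENNReal.rpow_mul, mul_one_div_cancel hr.ne', ENNReal.rpow_one]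

theorem strongNorm_comp_le {r : ℝ} (hr : 0 < r) {f : ι → κ} (hf : f.Injective) (x : κ → E) :
    strongNorm r (fun i => x (f i)) ≤ strongNorm r x :=
  ENNReal.rpow_le_rpow (ENNReal.tsum_comp_le_tsum_of_injective hf fun k => ‖x k‖ₑ ^ r)
    (one_div_pos.2 hr).le

theorem strongNorm_comp_eq {r : ℝ} (hr : 0 < r) {f : ι → κ} (hf : f.Injective) (x : κ → E)
    (hx : ∀ k ∉ Set.range f, x k = 0) :
    strongNorm r (fun i => x (f i)) = strongNorm r x := by
  unfold strongNorm
  rw [hf.tsum_eq (f := fun k => ‖x k‖ₑ ^ r)]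
  refine fun k hk => by_contra fun h => hk ?_
  simp [hx k h, hr]

theorem strongNorm_extend {r : ℝ} (hr : 0 < r) {f : ι → κ} (hf : f.Injective) (x : ι → E) :
    strongNorm r (Function.extend f x 0) = strongNorm r x := by
  rw [← strongNorm_comp_eq hr hf]
  · simp [hf.extend_apply]
  · exact fun k hk => Function.extend_apply' _ _ _ hk

/-- A family of blocks with geometrically decreasing norms has finite norm. -/
theorem strongNorm_sigma_lt_top {α : ℕ → Type*} {r : ℝ} (hr : 1 ≤ r) {x : ∀ N, α N → E} {C : ℝ≥0∞}
    (hC : C ≠ ∞) (h : ∀ N, strongNorm r (x N) ≤ C * 2⁻¹ ^ N) :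
    strongNorm r (fun i : Σ N, α N => x i.1 i.2) < ∞ := by
  have hr0 : 0 < r := by linarith
  rw [strongNorm_lt_top_iff hr0, ENNReal.tsum_sigma']
  calc ∑' N, ∑' i, ‖x N i‖ₑ ^ r ≤ ∑' N : ℕ, C ^ r * 2⁻¹ ^ N := by
        refine ENNReal.tsum_le_tsum fun N => ?_
        rw [← strongNorm_rpow hr0]
        refine (ENNReal.rpow_le_rpow (h N) hr0.le).trans ?_
        rw [ENNReal.mul_rpow_of_nonneg _ _ hr0.le]
        gcongr
        -- As `r ≥ 1`, raising `2⁻ᴺ` to the power `r` only decreases it, so a geometric series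
        -- dominates.
        exact ENNReal.rpow_le_self_of_le_one (pow_le_one₀ zero_le (by simp)) hr
    _ < ∞ := by
        rw [ENNReal.tsum_mul_left, ENNReal.tsum_geometric]
        refine ENNReal.mul_lt_top (ENNReal.rpow_lt_top_of_nonneg hr0.le hC) ?_
        simp [ENNReal.one_sub_inv_two]

theorem strongNorm_apply_le (p : ℝ) (hp : 0 < p) (u : ι → E) (φ : StrongDual 𝕜 E) :
    strongNorm p (fun j => φ (u j)) ≤ ‖φ‖ₑ * weakNorm 𝕜 p u := by
  rcases eq_or_ne φ 0 with rfl | hφ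
  · simp [strongNorm, hp]
  have hn : ‖φ‖ ≠ 0 := norm_ne_zero_iff.2 hφ
  have hmem : ((‖φ‖⁻¹ : ℝ) : 𝕜) • φ ∈ Metric.closedBall (0 : StrongDual 𝕜 E) 1 := by
    simp [norm_smul, hn]
  have h1 : (fun j => φ (u j)) =
      fun j => ((‖φ‖ : ℝ) : 𝕜) • (((‖φ‖⁻¹ : ℝ) : 𝕜) • φ) (u j) := by
    ext j
    simp [hn]
  rw [h1, strongNorm_smul hp]
  have h2 : ‖((‖φ‖ : ℝ) : 𝕜)‖ₑ = ‖φ‖ₑ := by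
    rw [← ofReal_norm, ← ofReal_norm]; simp
  rw [h2]
  gcongr
  exact le_iSup₂ (f := fun (φ : StrongDual 𝕜 E) (_ : φ ∈ Metric.closedBall 0 1) =>
    strongNorm p (fun j => φ (u j))) _ hmem

theorem weakNorm_le_strongNorm {p : ℝ} (hp : 0 < p) (u : ι → E) :
    weakNorm 𝕜 p u ≤ strongNorm p u := by
  refine iSup₂_le fun φ hφ => strongNorm_mono hp fun k => ?_
  rw [mem_closedBall_zero_iff] at hφ
  rw [enorm_le_iff_norm_le]
  exact (φ.le_opNorm _).trans (mul_le_of_le_one_left (norm_nonneg _) hφ)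

theorem weakNorm_smul {p : ℝ} (hp : 0 < p) (c : 𝕜) (u : ι → E) :
    weakNorm 𝕜 p (fun k => c • u k) = ‖c‖ₑ * weakNorm 𝕜 p u := by
  simp only [weakNorm, map_smul, strongNorm_smul hp, ENNReal.mul_iSup]

theorem weakNorm_comp_le {p : ℝ} (hp : 0 < p) {f : ι → κ} (hf : f.Injective) (u : κ → E) :
    weakNorm 𝕜 p (fun i => u (f i)) ≤ weakNorm 𝕜 p u :=
  iSup₂_mono fun φ _ => strongNorm_comp_le hp hf fun k => φ (u k)

theorem apply_extend (f : ι → κ) (u : ι → E) (φ : StrongDual 𝕜 E) :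
    (fun k => φ (Function.extend f u 0 k)) = Function.extend f (fun i => φ (u i)) 0 := by
  ext k
  unfold Function.extend
  split <;> simp

theorem weakNorm_extend {p : ℝ} (hp : 0 < p) {f : ι → κ} (hf : f.Injective) (u : ι → E) :
    weakNorm 𝕜 p (Function.extend f u 0) = weakNorm 𝕜 p u := by
  simp only [weakNorm, apply_extend, strongNorm_extend hp hf]

/-- A weakly `p`-summable sequence has finite weak norm, by the closed graph theorem. -/
theorem MemWeak.weakNorm_lt_top {p : ℝ} (hp : 1 ≤ p) {u : ℕ → E} (hu : MemWeak 𝕜 p u) :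
    weakNorm 𝕜 p u < ∞ := by
  have hp0 : 0 < p := by linarith
  have hp' : (ENNReal.ofReal p).toReal = p := ENNReal.toReal_ofReal hp0.le
  have : Fact (1 ≤ ENNReal.ofReal p) := ⟨by simpa using hp⟩
  let G : StrongDual 𝕜 E →ₗ[𝕜] lp (fun _ : ℕ => 𝕜) (ENNReal.ofReal p) :=
    { toFun := fun φ => ⟨fun j => φ (u j), hu φ⟩
      map_add' := fun _ _ => rfl
      map_smul' := fun _ _ => rfl }
  have hG (φ : StrongDual 𝕜 E) (j : ℕ) : G φ j = φ (u j) := rfl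
  have hcont : Continuous G := by
    -- Coordinates are continuous on `lp` and evaluation at `u j` is continuous on the dual, so
    -- limits in the graph are identified coordinatewise.
    refine G.continuous_of_seq_closed_graph fun φ x y hφ hy => ?_
    refine lp.ext (funext fun j => ?_)
    have h1 : Tendsto (fun n => G (φ n) j) atTop (𝓝 (y j)) :=
      (((continuous_apply j).comp lp.uniformContinuous_coe.continuous).tendsto y).comp hy
    have h2 : Tendsto (fun n => G (φ n) j) atTop (𝓝 (x (u j))) :=
      ((ContinuousLinearMap.apply 𝕜 𝕜 (u j)).continuous.tendsto x).comp hφ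
    exact tendsto_nhds_unique h2 h1 |>.symm
  let G' : StrongDual 𝕜 E →L[𝕜] lp (fun _ : ℕ => 𝕜) (ENNReal.ofReal p) := ⟨G, hcont⟩
  refine lt_of_le_of_lt (iSup₂_le fun φ hφ => ?_) (ENNReal.ofReal_lt_top (r := ‖G'‖))
  rw [mem_closedBall_zero_iff] at hφ
  have hle : ‖G φ‖ ≤ ‖G'‖ :=
    (G'.le_opNorm φ).trans (mul_le_of_le_one_right (norm_nonneg _) hφ)
  have hsum := lp.hasSum_norm (by rwa [hp']) (G φ)
  rw [hp'] at hsum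
  have h3 : strongNorm p (fun j => φ (u j)) ^ p = ENNReal.ofReal (‖G φ‖ ^ p) := by
    rw [strongNorm_rpow hp0, ← hsum.tsum_eq,
      ENNReal.ofReal_tsum_of_nonneg (fun _ => by positivity) hsum.summable]
    refine tsum_congr fun j => ?_
    rw [hG, ← ENNReal.ofReal_rpow_of_nonneg (norm_nonneg _) hp0.le, ofReal_norm]
  rw [← ENNReal.rpow_le_rpow_iff hp0, h3,
    ← ENNReal.ofReal_rpow_of_nonneg (norm_nonneg _) hp0.le]
  gcongr

theorem mixedNorm_lt_top_iff {s q : ℝ} (hq : 0 < q) (a : ι → κ → 𝕜) :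
    mixedNorm s q a < ∞ ↔ ∑' j, (∑' k, ‖a j k‖ₑ ^ s) ^ (q / s) < ∞ :=
  ENNReal.rpow_lt_top_iff_of_pos (one_div_pos.2 hq)

theorem mixedNorm_smul {s q : ℝ} (hs : 0 < s) (hq : 0 < q) (c : 𝕜) (a : ι → κ → 𝕜) :
    mixedNorm s q (fun j k => c * a j k) = ‖c‖ₑ * mixedNorm s q a := by
  simp only [mixedNorm, enorm_mul]
  simp_rw [ENNReal.mul_rpow_of_nonneg _ _ hs.le, ENNReal.tsum_mul_left,
    ENNReal.mul_rpow_of_nonneg _ _ (div_pos hq hs).le, ← ENNReal.rpow_mul,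
    mul_div_cancel₀ q hs.ne']
  rw [ENNReal.tsum_mul_left, ENNReal.mul_rpow_of_nonneg _ _ (one_div_pos.2 hq).le,
    ← ENNReal.rpow_mul, mul_one_div_cancel hq.ne', ENNReal.rpow_one]

theorem mixedNorm_comp_le {s q : ℝ} (hs : 0 < s) (hq : 0 < q) {f : ι → ι'} (hf : f.Injective)
    {g : κ → κ'} (hg : g.Injective) (a : ι' → κ' → 𝕜) :
    mixedNorm s q (fun j k => a (f j) (g k)) ≤ mixedNorm s q a := by
  refine ENNReal.rpow_le_rpow ?_ (one_div_pos.2 hq).le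
  refine le_trans (ENNReal.tsum_le_tsum fun j => ?_)
    (ENNReal.tsum_comp_le_tsum_of_injective hf fun j => (∑' k, ‖a j k‖ₑ ^ s) ^ (q / s))
  exact ENNReal.rpow_le_rpow
    (ENNReal.tsum_comp_le_tsum_of_injective hg fun k => ‖a (f j) k‖ₑ ^ s) (div_pos hq hs).le

theorem mixedNorm_eq_zero {s q : ℝ} (hs : 0 < s) (hq : 0 < q) {a : ι → κ → 𝕜}
    (h : ∀ j k, a j k = 0) : mixedNorm s q a = 0 := by
  simp [mixedNorm, h, hs, hq]

theorem continuous_mixedNorm [Finite ι] [Finite κ] (s q : ℝ) :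
    Continuous (mixedNorm s q : (ι → κ → 𝕜) → ℝ≥0∞) := by
  have := Fintype.ofFinite ι
  have := Fintype.ofFinite κ
  unfold mixedNorm
  simp only [tsum_fintype]
  refine ENNReal.continuous_rpow_const.comp (continuous_finsetSum _ fun j _ =>
    ENNReal.continuous_rpow_const.comp (continuous_finsetSum _ fun k _ =>
    ENNReal.continuous_rpow_const.comp (continuous_enorm.comp (by fun_prop))))

/-- The mixed norm of an infinite matrix is controlled by those of its finite sections. -/
theorem mixedNorm_le_of_fin {s q : ℝ} (hq : 0 < q) {a : ℕ → ℕ → 𝕜} {C : ℝ≥0∞}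
    (h : ∀ m n : ℕ, mixedNorm s q (fun (j : Fin m) (k : Fin n) => a j k) ≤ C) :
    mixedNorm s q a ≤ C := by
  have key (c d : ℝ≥0∞) : c ^ (1 / q) ≤ d ↔ c ≤ d ^ q := by
    rw [one_div, ENNReal.rpow_inv_le_iff hq]
  rw [mixedNorm, key]
  refine ENNReal.tsum_le_of_sum_range_le fun m => ?_
  -- The outer sum is already cut at `m`; a finite sum of powers lets `n → ∞` be taken inside each
  -- row.
  have hlim : Tendsto
      (fun n => ∑ j ∈ Finset.range m, (∑ k ∈ Finset.range n, ‖a j k‖ₑ ^ s) ^ (q / s)) atTop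
      (𝓝 (∑ j ∈ Finset.range m, (∑' k, ‖a j k‖ₑ ^ s) ^ (q / s))) :=
    tendsto_finsetSum _ fun j _ =>
      (ENNReal.continuous_rpow_const.tendsto _).comp (ENNReal.tendsto_nat_tsum _)
  refine le_of_tendsto' hlim fun n => ?_
  have := h m n
  rw [mixedNorm, key] at this
  simpa only [tsum_fintype, Finset.sum_range] using this

end Norms

/-! ### Goldstine approximation by Hahn–Banach separation -/

section Goldstine

variable {𝕜 X : Type*} [RCLike 𝕜] [NormedAddCommGroup X] [NormedSpace 𝕜 X]

/-- **Goldstine's theorem** for finitely many functionals: an element of the bidual is approximated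
on them by vectors whose norm is not larger. -/
theorem mem_closure_image_closedBall {m : ℕ} (f : Fin m → StrongDual 𝕜 X)
    (Φ : StrongDual 𝕜 (StrongDual 𝕜 X)) :
    (fun j => Φ (f j)) ∈ closure ((fun x j => f j x) '' Metric.closedBall (0 : X) ‖Φ‖) := by
  by_contra h
  let A : X →L[𝕜] (Fin m → 𝕜) := ContinuousLinearMap.pi f
  have hconv : Convex ℝ (closure ((fun x j => f j x) '' Metric.closedBall (0 : X) ‖Φ‖)) := by
    let _ : NormedSpace ℝ X := NormedSpace.restrictScalars ℝ 𝕜 X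
    have : IsScalarTower ℝ 𝕜 X := RestrictScalars.isScalarTower ℝ 𝕜 X
    exact ((convex_closedBall (0 : X) ‖Φ‖).is_linear_image (f := A)
      ⟨fun x y => map_add A x y, fun c x => (A.restrictScalars ℝ).map_smul c x⟩).closure
  obtain ⟨g, t, hlt, htg⟩ := RCLike.geometric_hahn_banach_closed_point (𝕜 := 𝕜) hconv
    isClosed_closure h
  let c (j : Fin m) : 𝕜 := g (Pi.single j 1)
  have hg (v : Fin m → 𝕜) : g v = ∑ j, c j * v j := by
    conv_lhs => rw [pi_eq_sum_univ' v, map_sum]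
    refine Finset.sum_congr rfl fun j _ => ?_
    rw [map_smul, smul_eq_mul, mul_comm]
  -- The separating functional `g` on `𝕜ᵐ` pulls back to `F` on `X`; the contradiction will be `‖Φ‖
  -- * ‖F‖ ≤ t < re (Φ F)`.
  let F : StrongDual 𝕜 X := ∑ j, c j • f j
  have hF (x : X) : F x = g (fun j => f j x) := by simp [F, hg]
  have hΦ : Φ F = g (fun j => Φ (f j)) := by simp [F, hg]
  have hball (x : X) (hx : ‖x‖ ≤ ‖Φ‖) : ‖F x‖ ≤ t := by
    -- Separation bounds only the real part; rotating `x` by a unimodular `z` turns it into `‖F x‖`.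
    obtain ⟨z, hz, hzx⟩ := RCLike.exists_norm_eq_mul_self (F x)
    have h1 := hlt _ (subset_closure ⟨z • x, by simpa [norm_smul, hz] using hx, rfl⟩)
    rw [← hF, map_smul, smul_eq_mul, ← hzx, RCLike.ofReal_re] at h1
    exact h1.le
  have hnorm : ‖Φ‖ * ‖F‖ ≤ t := by
    rcases Φ.opNorm_nonneg.eq_or_lt with h0 | hpos
    · rw [← h0, zero_mul]
      exact (norm_nonneg _).trans (hball 0 (norm_zero.trans_le Φ.opNorm_nonneg))
    · have := ContinuousLinearMap.opNorm_bound_of_ball_bound hpos t F fun x hx =>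
        hball x (by simpa using hx)
      rwa [le_div_iff₀' hpos] at this
  have h2 := (RCLike.re_le_norm (Φ F)).trans (Φ.le_opNorm F)
  rw [hΦ] at h2
  linarith

end Goldstine

/-! ### Finite inequalities and their equivalence with the summing conditions -/

section FiniteBound

variable {𝕜 U Y X : Type*} [RCLike 𝕜] [NormedAddCommGroup U] [NormedSpace 𝕜 U]
  [NormedAddCommGroup Y] [NormedSpace 𝕜 Y] [NormedAddCommGroup X] [NormedSpace 𝕜 X]

/-- The inequality with constant `D`, for finite families in `U` and in `Y*`. -/
def FiniteBound (s q r p : ℝ) (T : U →L[𝕜] Y) (D : ℝ) : Prop :=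
  ∀ (m n : ℕ) (u : Fin m → U) (φ : Fin n → StrongDual 𝕜 Y),
    mixedNorm s q (fun j k => φ k (T (u j))) ≤
      ENNReal.ofReal D * strongNorm r φ * weakNorm 𝕜 p u

theorem FiniteBound.isWeaklyAnisotropicSumming {s q r p D : ℝ} (hp : 1 ≤ p) (hq : 0 < q)
    (hr : 0 < r) {T : U →L[𝕜] Y} (h : FiniteBound s q r p T D) :
    IsWeaklyAnisotropicSumming s q r p T := by
  intro u hu φ hφ
  rw [← mixedNorm_lt_top_iff hq]
  refine (mixedNorm_le_of_fin (C := ENNReal.ofReal D * strongNorm r φ * weakNorm 𝕜 p u) hq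
    fun m n => ?_).trans_lt ?_
  · refine (h m n (fun j => u j) fun k => φ k).trans ?_
    gcongr
    · exact strongNorm_comp_le hr Fin.val_injective φ
    · exact weakNorm_comp_le (by linarith) Fin.val_injective u
  · exact ENNReal.mul_lt_top (ENNReal.mul_lt_top ENNReal.ofReal_lt_top ((memStrong_iff hr φ).1 hφ))
      (hu.weakNorm_lt_top hp)

/-- Both sides are homogeneous in `u` and in `φ` separately, so a violating pair can be rescaled
until both norms equal `ε`. These are the blocks to be glued. -/
theorem exists_small_of_not_finiteBound {s q r p : ℝ} (hs : 0 < s) (hq : 0 < q) (hr : 0 < r)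
    (hp : 0 < p) {T : U →L[𝕜] Y} (h : ∀ D > 0, ¬ FiniteBound s q r p T D) {ε : ℝ} (hε : 0 < ε) :
    ∃ (m n : ℕ) (u : Fin m → U) (φ : Fin n → StrongDual 𝕜 Y),
      weakNorm 𝕜 p u ≤ ENNReal.ofReal ε ∧ strongNorm r φ ≤ ENNReal.ofReal ε ∧
        1 ≤ mixedNorm s q (fun j k => φ k (T (u j))) := by
  -- Rescaling multiplies the mixed norm by `ε² / (σ w)`, where `w` and `σ` are the weak and strong
  -- norms; violating this constant makes the result at least `1`.
  have h' := h (1 / (ε * ε)) (by positivity)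
  simp only [FiniteBound, not_forall, not_le] at h'
  obtain ⟨m, n, u, φ, hlt⟩ := h'
  -- If either norm vanished, the whole matrix would be zero and nothing could be violated; hence
  -- the divisions by `w` and `σ` are legitimate.
  have hW : weakNorm 𝕜 p u ≠ 0 := fun h0 => by
    rw [mixedNorm_eq_zero hs hq] at hlt
    · exact not_lt_zero hlt
    intro j k
    have h1 := (enorm_le_strongNorm hp _ j).trans (strongNorm_apply_le p hp u (φ k ∘L T))
    simpa [h0] using h1
  have hS : strongNorm r φ ≠ 0 := fun h0 => by
    rw [mixedNorm_eq_zero hs hq] at hlt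
    · exact not_lt_zero hlt
    intro j k
    have h1 := enorm_le_strongNorm hr φ k
    have h2 : φ k = 0 := by simpa [h0] using h1
    simp [h2]
  have hW' : weakNorm 𝕜 p u ≠ ∞ :=
    ((weakNorm_le_strongNorm hp u).trans_lt (strongNorm_lt_top_of_finite hp u)).ne
  have hS' : strongNorm r φ ≠ ∞ := (strongNorm_lt_top_of_finite hr φ).ne
  have hc (x : ℝ) (hx : 0 ≤ x) : ‖((x : ℝ) : 𝕜)‖ₑ = ENNReal.ofReal x := by
    rw [← ofReal_norm]; simp [abs_of_nonneg hx]
  lift weakNorm 𝕜 p u to NNReal using hW' with w hw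
  lift strongNorm r φ to NNReal using hS' with σ hσ
  have hw0 : 0 < (w : ℝ) := by simpa [pos_iff_ne_zero] using hW
  have hσ0 : 0 < (σ : ℝ) := by simpa [pos_iff_ne_zero] using hS
  refine ⟨m, n, fun j => ((ε / w : ℝ) : 𝕜) • u j, fun k => ((ε / σ : ℝ) : 𝕜) • φ k, ?_, ?_, ?_⟩
  · rw [weakNorm_smul hp, ← hw, hc _ (by positivity), ← ENNReal.ofReal_coe_nnreal,
      ← ENNReal.ofReal_mul (by positivity), div_mul_cancel₀ _ hw0.ne']
  · rw [strongNorm_smul hr, ← hσ, hc _ (by positivity), ← ENNReal.ofReal_coe_nnreal,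
      ← ENNReal.ofReal_mul (by positivity), div_mul_cancel₀ _ hσ0.ne']
  · have h3 : (fun (j : Fin m) (k : Fin n) =>
        (((ε / σ : ℝ) : 𝕜) • φ k) (T (((ε / w : ℝ) : 𝕜) • u j))) =
        fun j k => (((ε / σ) * (ε / w) : ℝ) : 𝕜) * φ k (T (u j)) := by
      ext j k
      simp only [map_smul, smul_apply, smul_eq_mul, RCLike.ofReal_mul]
      ring
    rw [h3, mixedNorm_smul hs hq, hc _ (by positivity)]
    refine le_trans ?_ (mul_le_mul_right hlt.le _)
    rw [← ENNReal.ofReal_coe_nnreal, ← ENNReal.ofReal_coe_nnreal,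
      ← ENNReal.ofReal_mul (by positivity), ← ENNReal.ofReal_mul (by positivity),
      ← ENNReal.ofReal_mul (by positivity), ENNReal.one_le_ofReal]
    refine le_of_eq ?_
    field_simp

/-- A weakly anisotropic summing operator is bounded on finite families. If not, blocks of finite
families violating the bound are put together to a pair of sequences violating the definition. -/
theorem IsWeaklyAnisotropicSumming.exists_finiteBound {s q r p : ℝ} (hp : 1 ≤ p) (hs : 0 < s)
    (hq : 0 < q) (hr : 1 ≤ r) {T : U →L[𝕜] Y} (h : IsWeaklyAnisotropicSumming s q r p T) :
    ∃ D : ℝ, 0 < D ∧ FiniteBound s q r p T D := by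
  by_contra! hcon
  have hp0 : 0 < p := by linarith
  have hr0 : 0 < r := by linarith
  choose m n u φ hu hφ h1 using fun N : ℕ =>
    exists_small_of_not_finiteBound hs hq hr0 hp0 hcon (ε := 2⁻¹ ^ N) (by positivity)
  have hpow (N : ℕ) : ENNReal.ofReal (2⁻¹ ^ N) = 2⁻¹ ^ N := by
    rw [ENNReal.ofReal_pow (by positivity), ENNReal.ofReal_inv_of_pos (by positivity)]
    simp
  simp only [hpow] at hu hφ
  -- The blocks are laid out along an injective coding of their index pairs into `ℕ`, with zeros at
  -- unused positions, so no norm changes.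
  let v : ℕ → U := Function.extend Encodable.encode (fun i : Σ N, Fin (m N) => u i.1 i.2) 0
  let ψ : ℕ → StrongDual 𝕜 Y :=
    Function.extend Encodable.encode (fun i : Σ N, Fin (n N) => φ i.1 i.2) 0
  have hv : MemWeak 𝕜 p v := fun χ => by
    rw [memStrong_iff hp0, apply_extend, strongNorm_extend hp0 Encodable.encode_injective]
    exact strongNorm_sigma_lt_top hp (x := fun N i => χ (u N i)) (enorm_ne_top (x := χ)) fun N =>
      (strongNorm_apply_le p hp0 (u N) χ).trans (by gcongr; exact hu N)
  have hψ : MemStrong r ψ := by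
    rw [memStrong_iff hr0, strongNorm_extend hr0 Encodable.encode_injective]
    exact strongNorm_sigma_lt_top hr (x := φ) ENNReal.one_ne_top fun N => by simpa using hφ N
  have hfin := (mixedNorm_lt_top_iff hq _).2 (h v hv ψ hψ)
  have hle := mixedNorm_comp_le hs hq
    (Encodable.encode_injective (α := Σ N, Fin (m N)))
    (Encodable.encode_injective (α := Σ N, Fin (n N))) fun j k => ψ k (T (v j))
  have hlt := (mixedNorm_lt_top_iff hq _).1 (hle.trans_lt hfin)
  simp only [v, ψ, Encodable.encode_injective.extend_apply] at hlt
  rw [ENNReal.tsum_sigma'] at hlt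
  refine hlt.ne (top_le_iff.1 ?_)
  -- Each diagonal block, `u N` against `φ N`, contributes at least `1`; the off-diagonal terms are
  -- nonnegative and are dropped.
  calc ∞ = ∑' _ : ℕ, (1 : ℝ≥0∞) := by simp
    _ ≤ ∑' N, ∑' i, (∑' k, ‖φ N k (T (u N i))‖ₑ ^ s) ^ (q / s) := by
        refine ENNReal.tsum_le_tsum fun N => ?_
        have := h1 N
        rwa [mixedNorm, ← ENNReal.one_rpow (1 / q),
          ENNReal.rpow_le_rpow_iff (one_div_pos.2 hq)] at this
    _ ≤ _ := by
        refine ENNReal.tsum_le_tsum fun N => ENNReal.tsum_le_tsum fun i => ?_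
        refine ENNReal.rpow_le_rpow ?_ (div_pos hq hs).le
        exact ENNReal.tsum_comp_le_tsum_of_injective (sigma_mk_injective (i := N))
          fun k : Σ N, Fin (n N) => ‖φ k.1 k.2 (T (u N i))‖ₑ ^ s

/-- One direction embeds `X` in its bidual; the other applies Goldstine to each `φ k` separately and
passes to the limit, the mixed norm of a finite matrix being continuous in its entries. -/
theorem finiteBound_iff_predualBoundFinite {s q r p D : ℝ} (hr : 0 < r)
    (T : U →L[𝕜] StrongDual 𝕜 X) : FiniteBound s q r p T D ↔ PredualBoundFinite s q r p T D := by
  constructor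
  · intro h m n u x
    refine (h m n u fun k => NormedSpace.inclusionInDoubleDual 𝕜 X (x k)).trans ?_
    gcongr
    refine strongNorm_mono hr fun k => ?_
    rw [enorm_le_iff_norm_le]
    exact NormedSpace.double_dual_bound 𝕜 X (x k)
  · intro h m n u φ
    have hseq (k : Fin n) : ∃ x : ℕ → X, (∀ N, ‖x N‖ ≤ ‖φ k‖) ∧
        Tendsto (fun N j => T (u j) (x N)) atTop (𝓝 fun j => φ k (T (u j))) := by
      obtain ⟨y, hy, hlim⟩ := mem_closure_iff_seq_limit.1
        (mem_closure_image_closedBall (fun j => T (u j)) (φ k))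
      choose x hx hxy using hy
      obtain rfl := funext hxy
      exact ⟨x, fun N => by simpa using hx N, hlim⟩
    choose x hx hlim using hseq
    have hlim' : Tendsto (fun N j k => T (u j) (x k N)) atTop (𝓝 fun j k => φ k (T (u j))) :=
      tendsto_pi_nhds.2 fun j => tendsto_pi_nhds.2 fun k => tendsto_pi_nhds.1 (hlim k) j
    refine le_of_tendsto' (((continuous_mixedNorm s q).tendsto _).comp hlim') fun N => ?_
    refine (h m n u fun k => x k N).trans ?_
    gcongr
    refine strongNorm_mono hr fun k => ?_
    rw [enorm_le_iff_norm_le]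
    exact hx k N

theorem PredualBound.semifinite {s q r p D : ℝ} (hs : 0 < s) (hq : 0 < q) (hp : 0 < p)
    {T : U →L[𝕜] StrongDual 𝕜 X} (h : PredualBound s q r p T D) :
    PredualBoundSemifinite s q r p T D := by
  intro m u x hx
  have hu : MemWeak 𝕜 p (Function.extend Fin.val u 0) := fun φ => by
    rw [memStrong_iff hp, apply_extend, strongNorm_extend hp Fin.val_injective]
    exact strongNorm_lt_top_of_finite hp _
  have h1 := h _ x hu hx
  rw [weakNorm_extend hp Fin.val_injective] at h1
  refine le_trans ?_ h1
  simpa only [Fin.val_injective.extend_apply, id] using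
    mixedNorm_comp_le hs hq (Fin.val_injective (n := m)) Function.injective_id
      fun j k => T (Function.extend Fin.val u 0 j) (x k)

theorem PredualBoundSemifinite.finite {s q r p D : ℝ} (hs : 0 < s) (hq : 0 < q) (hr : 0 < r)
    {T : U →L[𝕜] StrongDual 𝕜 X} (h : PredualBoundSemifinite s q r p T D) :
    PredualBoundFinite s q r p T D := by
  intro m n u x
  have hx : MemStrong r (Function.extend Fin.val x 0) := by
    rw [memStrong_iff hr, strongNorm_extend hr Fin.val_injective]
    exact strongNorm_lt_top_of_finite hr _
  have h1 := h m u _ hx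
  rw [strongNorm_extend hr Fin.val_injective] at h1
  refine le_trans ?_ h1
  simpa only [Fin.val_injective.extend_apply, id] using
    mixedNorm_comp_le hs hq Function.injective_id (Fin.val_injective (n := n))
      fun j k => T (u j) (Function.extend Fin.val x 0 k)

theorem PredualBoundFinite.predualBound {s q r p D : ℝ} (hq : 0 < q) (hr : 0 < r) (hp : 0 < p)
    {T : U →L[𝕜] StrongDual 𝕜 X} (h : PredualBoundFinite s q r p T D) :
    PredualBound s q r p T D := by
  intro u x _ _
  refine mixedNorm_le_of_fin hq fun m n => (h m n (fun j => u j) fun k => x k).trans ?_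
  gcongr
  · exact strongNorm_comp_le hr Fin.val_injective x
  · exact weakNorm_comp_le hp Fin.val_injective u

/-- The infimum of the admissible constants is admissible. -/
theorem predualBoundFinite_sInf {s q r p : ℝ} (hr : 0 < r) (hp : 0 < p)
    {T : U →L[𝕜] StrongDual 𝕜 X} (h : ∃ D : ℝ, 0 < D ∧ PredualBoundFinite s q r p T D) :
    PredualBoundFinite s q r p T (sInf {D : ℝ | 0 < D ∧ PredualBoundFinite s q r p T D}) := by
  intro m n u x
  obtain ⟨D, -, hD, hmem⟩ := exists_seq_tendsto_sInf
    (S := {D : ℝ | 0 < D ∧ PredualBoundFinite s q r p T D}) h ⟨0, fun D hD => hD.1.le⟩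
  have hW : weakNorm 𝕜 p u ≠ ∞ :=
    ((weakNorm_le_strongNorm hp u).trans_lt (strongNorm_lt_top_of_finite hp u)).ne
  have hS : strongNorm r x ≠ ∞ := (strongNorm_lt_top_of_finite hr x).ne
  -- The infimum may be `0`, where multiplication in `[0, ∞]` is discontinuous against `∞`;
  -- finiteness of both norms is what allows the limit.
  exact ge_of_tendsto' (ENNReal.Tendsto.mul_const (ENNReal.Tendsto.mul_const
    (ENNReal.tendsto_ofReal hD) (.inr hS)) (.inr hW)) fun N => (hmem N).2 m n u x

end FiniteBound

end AnisotropicSumming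

theorem mainTheorem12 {𝕜 U X : Type*} [RCLike 𝕜]
    [NormedAddCommGroup U] [NormedSpace 𝕜 U] [CompleteSpace U]
    [NormedAddCommGroup X] [NormedSpace 𝕜 X] [CompleteSpace X]
    (s q r p : ℝ) (hp : 1 ≤ p) (hpq : p ≤ q) (hqs : q < s) (hr : 1 ≤ r) (hrs : r ≤ s)
    (T : U →L[𝕜] StrongDual 𝕜 X) :
    [AnisotropicSumming.IsWeaklyAnisotropicSumming s q r p T,
      ∃ D : ℝ, 0 < D ∧ AnisotropicSumming.PredualBound s q r p T D,
      ∃ D : ℝ, 0 < D ∧ AnisotropicSumming.PredualBoundSemifinite s q r p T D,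
      ∃ D : ℝ, 0 < D ∧ AnisotropicSumming.PredualBoundFinite s q r p T D].TFAE ∧
    (AnisotropicSumming.IsWeaklyAnisotropicSumming s q r p T →
      AnisotropicSumming.PredualBound s q r p T
        (AnisotropicSumming.weakAnisotropicNorm s q r p T) ∧
      AnisotropicSumming.weakAnisotropicNorm s q r p T =
        sInf {D : ℝ | 0 < D ∧ AnisotropicSumming.PredualBound s q r p T D} ∧
      AnisotropicSumming.weakAnisotropicNorm s q r p T =
        sInf {D : ℝ | 0 < D ∧ AnisotropicSumming.PredualBoundSemifinite s q r p T D} ∧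
      AnisotropicSumming.weakAnisotropicNorm s q r p T =
        sInf {D : ℝ | 0 < D ∧ AnisotropicSumming.PredualBoundFinite s q r p T D}) := by
  have hp0 : 0 < p := by linarith
  have hq : 0 < q := by linarith
  have hs : 0 < s := by linarith
  have hr0 : 0 < r := by linarith
  open AnisotropicSumming in
  -- The equivalences hold for each fixed `D`, which gives equality of the infima and not only
  -- equivalence of the conditions.
  have h23 (D : ℝ) : PredualBound s q r p T D ↔ PredualBoundFinite s q r p T D :=
    ⟨fun h => (h.semifinite hs hq hp0).finite hs hq hr0, fun h => h.predualBound hq hr0 hp0⟩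
  open AnisotropicSumming in
  have h34 (D : ℝ) : PredualBoundSemifinite s q r p T D ↔ PredualBoundFinite s q r p T D :=
    ⟨fun h => h.finite hs hq hr0, fun h => (h.predualBound hq hr0 hp0).semifinite hs hq hp0⟩
  have h1 : AnisotropicSumming.IsWeaklyAnisotropicSumming s q r p T ↔
      ∃ D : ℝ, 0 < D ∧ AnisotropicSumming.PredualBoundFinite s q r p T D := by
    simp only [← AnisotropicSumming.finiteBound_iff_predualBoundFinite hr0]
    exact ⟨fun h => h.exists_finiteBound hp hs hq hr,
      fun ⟨_, _, h⟩ => h.isWeaklyAnisotropicSumming hp hq hr0⟩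
  have hnorm : AnisotropicSumming.weakAnisotropicNorm s q r p T =
      sInf {D : ℝ | 0 < D ∧ AnisotropicSumming.PredualBoundFinite s q r p T D} := by
    simp only [← AnisotropicSumming.finiteBound_iff_predualBoundFinite hr0]
    rfl
  simp only [h23, h34, h1]
  refine ⟨by tfae_finish, fun h => ⟨?_, hnorm, hnorm, hnorm⟩⟩
  rw [hnorm]
  exact AnisotropicSumming.predualBoundFinite_sInf hr0 hp0 h
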